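/- Let $D$ be a (continuous) Scott domain, i.e. a bounded complete dcpo with a countable basis, equipped with its Scott topology, and let $\ll$ denote the way-below relation of a dcpo. Let $\Omega$ be either the Cantor space $\{0,1\}^{\mathbb N}$ with the product topology and the uniform product measure $\nu$, or $[0,1]$ with the Euclidean topology and Lebesgue measure $\nu$. Call a finite union of cylinder sets (if $\Omega=\{0,1\}^{\mathbb N}$), respectively a finite union of relatively open intervals with dyadic endpoints (if $\Omega=[0,1]$), a basic open set. A random variable is a continuous map $r:\Omega\to D$; the set $(\Omega\to D)$ of random variables is ordered pointwise. A random variable is simple if it is of the form $\sup_{1\le i\le n} d_i\chi_{O_i}$ with $d_i\in D$ and $O_i$ basic open, where $d\chi_O$ has the value $d$ on $O$ and $\bot$ elsewhere. Let $PD$ be the set of normalised continuous valuations on $D$, ordered by $\mu\sqsubseteq\mu'$ iff $\mu(O)\le\mu'(O)$ for all Scott open $O\subseteq D$, and let $T:(\Omega\to D)\to PD$ be the map $T(r)=\nu\circ r^{-1}$. Then for every random variable $r\in(\Omega\to D)$ there exists an increasing sequence $(r_i)_{i\in\mathbb N}$ of simple random variables such that $r_i\ll r_{i+1}$ in $(\Omega\to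 D)$ and $T(r_i)\ll T(r)$ in $PD$ for every $i\in\mathbb N$, and $\sup_{i\in\mathbb N}r_i=r$ $\nu$-almost everywhere. -/

import Mathlib

open MeasureTheory TopologicalSpace Set

namespace ScottRV

/-! ### Domain theory -/

/-- `x ≪ y`: whenever a (non-empty) directed set `A` has a supremum above `y`, some element of `A`
is above `x`. -/
def WayBelow {D : Type*} [PartialOrder D] (x y : D) : Prop :=
  ∀ A : Set D, A.Nonempty → DirectedOn (· ≤ ·) A → ∀ s, IsLUB A s → y ≤ s → ∃ a ∈ A, x ≤ a

/-- A basis: every `y` is the lub of the (non-empty) directed set of basis elements way below it. -/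
def IsDomainBasis {D : Type*} [PartialOrder D] (B : Set D) : Prop :=
  ∀ y : D, {x ∈ B | WayBelow x y}.Nonempty ∧ DirectedOn (· ≤ ·) {x ∈ B | WayBelow x y} ∧
    IsLUB {x ∈ B | WayBelow x y} y

/-- A (continuous) Scott domain: a dcpo with a countable basis that is bounded complete.  The bottom
element, which exists by bounded completeness, is given by the instance `OrderBot D`. -/
structure IsScottDomain (D : Type*) [PartialOrder D] [OrderBot D] : Prop where
  exists_isLUB_of_directedOn : ∀ A : Set D, A.Nonempty → DirectedOn (· ≤ ·) A → ∃ s, IsLUB A s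
  exists_countable_basis : ∃ B : Set D, B.Countable ∧ IsDomainBasis B
  exists_isLUB_of_bddAbove : ∀ A : Set D, BddAbove A → ∃ s, IsLUB A s

/-! ### The normalised probabilistic power domain -/

/-- A normalised continuous valuation on a topological space `Y`. The total mass is `1` and the
valuation is monotone, so all its values lie in `[0, 1]`. -/
@[ext]
structure NormValuation (Y : Type*) [TopologicalSpace Y] where
  toFun : Opens Y → ENNReal
  modular : ∀ U V : Opens Y, toFun U + toFun V = toFun (U ⊔ V) + toFun (U ⊓ V)
  map_bot : toFun ⊥ = 0
  mono : ∀ U V : Opens Y, U ≤ V → toFun U ≤ toFun V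
  map_sSup : ∀ A : Set (Opens Y), A.Nonempty → DirectedOn (· ≤ ·) A →
    toFun (sSup A) = ⨆ U ∈ A, toFun U
  map_top : toFun ⊤ = 1

/-- The order of the normalised probabilistic power domain: `μ ⊑ ν` iff `μ O ≤ ν O` for all open
sets `O`. -/
instance (Y : Type*) [TopologicalSpace Y] : PartialOrder (NormValuation Y) :=
  PartialOrder.lift NormValuation.toFun fun _ _ h => NormValuation.ext h

/-- On a second countable space, a measure preserves directed unions of open sets. -/
theorem measure_sSup_of_directedOn {X : Type*} [TopologicalSpace X] [SecondCountableTopology X]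
    [MeasurableSpace X] (ν : Measure X) {ι : Type*} (A : Set ι) (f : ι → Set X)
    (hf : ∀ i ∈ A, IsOpen (f i)) (hdir : DirectedOn (fun i j => f i ⊆ f j) A) :
    ν (⋃ i ∈ A, f i) = ⨆ i ∈ A, ν (f i) := by
  apply le_antisymm
  · obtain ⟨T, hTc, hTA, hT⟩ := isOpen_sUnion_countable (f '' A)
      (by rintro _ ⟨i, hi, rfl⟩; exact hf i hi)
    rw [sUnion_image] at hT
    rw [← hT]
    rcases T.eq_empty_or_nonempty with rfl | hTne
    · simp
    obtain ⟨g, rfl⟩ := hTc.exists_eq_range hTne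
    rw [sUnion_range, measure_iUnion_eq_iSup_accumulate]
    refine iSup_le fun n => ?_
    have key : ∃ i ∈ A, accumulate g n ⊆ f i := by
      induction n with
      | zero =>
        obtain ⟨i, hi, hgi⟩ := hTA ⟨0, rfl⟩
        exact ⟨i, hi, by simp [accumulate, hgi]⟩
      | succ n ih =>
        obtain ⟨i, hi, hi'⟩ := ih
        obtain ⟨j, hj, hgj⟩ := hTA ⟨n + 1, rfl⟩
        obtain ⟨k, hk, hik, hjk⟩ := hdir i hi j hj
        refine ⟨k, hk, ?_⟩
        rw [accumulate_succ]
        exact union_subset (hi'.trans hik) (by rw [← hgj]; exact hjk)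
    obtain ⟨i, hi, hsub⟩ := key
    exact (measure_mono hsub).trans (le_iSup₂ (f := fun i (_ : i ∈ A) => ν (f i)) i hi)
  · exact iSup₂_le fun i hi => measure_mono (subset_biUnion_of_mem (u := f) hi)

section RandomVariables

variable {Ω : Type*} [TopologicalSpace Ω] {D : Type*} [PartialOrder D]

/-- The probability map `T`, sending a random variable `r : Ω → D` (a continuous map, where `D`
carries its Scott topology) to the normalised continuous valuation `O ↦ ν (r⁻¹ O)`. -/
noncomputable def probMap [SecondCountableTopology Ω] [MeasurableSpace Ω] [BorelSpace Ω]
    [TopologicalSpace D] (ν : Measure Ω) [IsProbabilityMeasure ν] (r : C(Ω, D)) :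
    NormValuation D where
  toFun O := ν (r ⁻¹' (O : Set D))
  modular U V := by
    rw [Opens.coe_sup, Opens.coe_inf, preimage_union, preimage_inter]
    exact (measure_union_add_inter _ (V.isOpen.preimage r.continuous).measurableSet).symm
  map_bot := by simp
  mono U V h := measure_mono (preimage_mono h)
  map_sSup A _ hdir := by
    rw [Opens.coe_sSup, preimage_iUnion₂]
    refine measure_sSup_of_directedOn ν A (fun U : Opens D => r ⁻¹' (U : Set D))
      (fun U _ => U.isOpen.preimage r.continuous) ?_
    intro U hU V hV
    obtain ⟨W, hW, h1, h2⟩ := hdir U hU V hV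
    exact ⟨W, hW, preimage_mono h1, preimage_mono h2⟩
  map_top := by simp

open Classical in
/-- The single-step function `d χ_O`, equal to `d` on `O` and to `⊥` elsewhere. -/
noncomputable def singleStep [OrderBot D] (d : D) (O : Set Ω) (ω : Ω) : D :=
  if ω ∈ O then d else ⊥

/-- `r` is a simple random variable with respect to the class `basic` of basic open sets: it is the
(pointwise) supremum of finitely many single-step functions built from basic open sets. -/
def IsSimpleRV [OrderBot D] [TopologicalSpace D] (basic : Set Ω → Prop) (r : C(Ω, D)) : Prop :=
  ∃ (n : ℕ) (d : Fin n → D) (O : Fin n → Set Ω), (∀ i, basic (O i)) ∧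
    ∀ ω, IsLUB (range fun i => singleStep (d i) (O i) ω) (r ω)

end RandomVariables

/-! ### The two sample spaces -/

/-- The uniform measure on a two-point space. -/
noncomputable def coinMeasure : Measure Bool := ProbabilityTheory.uniformOn univ

instance : IsProbabilityMeasure coinMeasure :=
  ProbabilityTheory.isProbabilityMeasure_uniformOn finite_univ univ_nonempty

/-- The uniform product measure on the Cantor space. -/
noncomputable def cantorMeasure : Measure (ℕ → Bool) := Measure.infinitePi fun _ => coinMeasure

noncomputable instance : IsProbabilityMeasure cantorMeasure := by
  unfold cantorMeasure; infer_instance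

/-- The cylinder set `[x₀ … xₙ₋₁]`. -/
def cylinder {n : ℕ} (x : Fin n → Bool) : Set (ℕ → Bool) := {ω | ∀ i : Fin n, ω i = x i}

/-- Basic open sets of the Cantor space: finite unions of cylinder sets.  (Whether the cylinder of
length `0` is read as the whole space or as the empty set makes no difference: both are finite
unions of cylinders of positive length.) -/
def IsBasicOpenCantor (U : Set (ℕ → Bool)) : Prop :=
  ∃ 𝒞 : Set (Set (ℕ → Bool)), 𝒞.Finite ∧
    (∀ C ∈ 𝒞, ∃ (n : ℕ) (x : Fin n → Bool), C = cylinder x) ∧ U = ⋃₀ 𝒞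

/-- A dyadic number. Negative numbers and numbers above `1` are allowed as endpoints below, so that
the relatively open intervals `[0, b)`, `(a, 1]` and `[0, 1]` are included. -/
def IsDyadic (a : ℝ) : Prop := ∃ (m : ℤ) (n : ℕ), a = m / 2 ^ n

/-- Basic open sets of `[0, 1]`: finite unions of (relatively) open intervals with dyadic
endpoints. -/
def IsBasicOpenInterval (U : Set unitInterval) : Prop :=
  ∃ 𝒞 : Set (Set unitInterval), 𝒞.Finite ∧
    (∀ C ∈ 𝒞, ∃ a b : ℝ, IsDyadic a ∧ IsDyadic b ∧ C = {ω | a < (ω : ℝ) ∧ (ω : ℝ) < b}) ∧ U = ⋃₀ 𝒞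

end ScottRV

namespace ScottRV

/-! ### The way-below relation and interpolation. -/

section Order

variable {D : Type*} [PartialOrder D]

/-! Write `r` as a supremum of countably many steps `d₀ k` on open sets `O k`, with `d₀ k ≪ e k ≪ r`
on `O k` (`exists_generating_steps`). Let `ρ n` be the supremum over `k < n` of steps `d k n` on `P
k n`, where the coefficients `d k n` form a `≪`-chain between `d₀ k` and `e k`, and the basic sets
`P k n` exhaust `O k` minus a finite set of points, each closure lying in the next set. By
compactness, growth of both coefficients and supports gives `ρ n ≪ ρ (n + 1)` (`wayBelow_of_steps`).

The punctures make the distributions way below. Since `ρ n` has finite range,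
`probMap_wayBelow_probMap` reduces the claim to a strict gain of measure, for each `S ∌ ⊥` that `ρ
n` reaches, from "`ρ n` is above a member of `S`" to "`r` is way above a member of `S`". Fix a point
`q K` in each nonempty intersection of the `O k`, `k ∈ K`, and delete from `O k` all `q K` with `K ⊆
{0, …, k}`. If `K` is chosen with least possible largest index `j` among the compatible sets whose
coefficients reach `S`, then near `q K` no step of index at least `j` is active. There `r` is still
way above a member of `S`, while by minimality `ρ n` is above none, so a nonempty open set is gained
(`exists_isOpen_of_shrunk_steps`).

Only countably many points are deleted in all, and these have measure zero; elsewhere the supremum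
is `r`. -/

theorem WayBelow.le {x y : D} (h : WayBelow x y) : x ≤ y := by
  obtain ⟨a, ha, hxa⟩ := h {y} (singleton_nonempty y) (directedOn_singleton y) y
    isLUB_singleton le_rfl
  exact (mem_singleton_iff.1 ha) ▸ hxa

theorem WayBelow.trans_le {x y z : D} (h : WayBelow x y) (hyz : y ≤ z) : WayBelow x z :=
  fun A hA hd s hs hzs => h A hA hd s hs (hyz.trans hzs)

theorem WayBelow.of_le {x y z : D} (hxy : x ≤ y) (h : WayBelow y z) : WayBelow x z := by
  intro A hA hd s hs hzs
  obtain ⟨a, ha, hya⟩ := h A hA hd s hs hzs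
  exact ⟨a, ha, hxy.trans hya⟩

/-- A finite nonempty collection of elements of a directed set has an upper bound in that set,
along any family of properties inherited upwards. -/
theorem DirectedOn.exists_forall_of_finite {A : Set D} (hA : A.Nonempty)
    (hd : DirectedOn (· ≤ ·) A) {ι : Type*} {s : Set ι} (hs : s.Finite) {p : ι → D → Prop}
    (hmono : ∀ i, ∀ a b, a ≤ b → p i a → p i b) (hp : ∀ i ∈ s, ∃ a ∈ A, p i a) :
    ∃ a ∈ A, ∀ i ∈ s, p i a := by
  induction s, hs using Set.Finite.induction_on with
  | empty => exact ⟨hA.some, hA.some_mem, by simp⟩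
  | @insert i s _ _ ih =>
    obtain ⟨a, ha, hia⟩ := ih fun j hj => hp j (mem_insert_of_mem _ hj)
    obtain ⟨b, hb, hib⟩ := hp i (mem_insert _ _)
    obtain ⟨c, hc, hac, hbc⟩ := hd a ha b hb
    refine ⟨c, hc, ?_⟩
    rintro j (rfl | hj)
    · exact hmono _ _ _ hbc hib
    · exact hmono _ _ _ hac (hia j hj)

theorem WayBelow.of_isLUB {F : Set D} (hF : F.Finite) {x y : D} (hx : IsLUB F x)
    (h : ∀ f ∈ F, WayBelow f y) : WayBelow x y := by
  intro A hA hd s hs hys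
  obtain ⟨a, ha, hFa⟩ := DirectedOn.exists_forall_of_finite hA hd hF (p := fun f a => f ≤ a)
    (fun _ _ _ hab h => h.trans hab) fun f hf => h f hf A hA hd s hs hys
  exact ⟨a, ha, hx.2 hFa⟩

theorem wayBelow_bot [OrderBot D] (y : D) : WayBelow ⊥ y :=
  fun _ hA _ _ _ _ => ⟨hA.some, hA.some_mem, bot_le⟩

variable {B : Set D}

/-- The basis elements lying two way-below steps under `z` are directed with supremum `z`, so one of
them is above `x`. -/
theorem IsDomainBasis.interpolate (hB : IsDomainBasis B) {x z : D} (h : WayBelow x z) :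
    ∃ y ∈ B, WayBelow x y ∧ WayBelow y z := by
  let A : Set D := {a ∈ B | ∃ b ∈ B, WayBelow a b ∧ WayBelow b z}
  have hmem : ∀ b ∈ B, WayBelow b z → ∀ a ∈ B, WayBelow a b → a ∈ A :=
    fun b hb hbz a ha hab => ⟨ha, b, hb, hab, hbz⟩
  have hA : A.Nonempty := by
    obtain ⟨b, hb, hbz⟩ := (hB z).1
    obtain ⟨a, ha, hab⟩ := (hB b).1
    exact ⟨a, hmem b hb hbz a ha hab⟩
  have hd : DirectedOn (· ≤ ·) A := by
    rintro a ⟨ha, b, hb, hab, hbz⟩ a' ⟨ha', b', hb', hab', hbz'⟩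
    obtain ⟨c, ⟨hc, hcz⟩, hbc, hbc'⟩ := (hB z).2.1 b ⟨hb, hbz⟩ b' ⟨hb', hbz'⟩
    obtain ⟨e, ⟨he, hec⟩, hae, hae'⟩ := (hB c).2.1 a ⟨ha, hab.trans_le hbc⟩ a'
      ⟨ha', hab'.trans_le hbc'⟩
    exact ⟨e, hmem c hc hcz e he hec, hae, hae'⟩
  have hlub : IsLUB A z := by
    refine ⟨fun a ⟨_, b, _, hab, hbz⟩ => hab.le.trans hbz.le, fun u hu => ?_⟩
    exact (hB z).2.2.2 fun b ⟨hb, hbz⟩ => (hB b).2.2.2 fun a ⟨ha, hab⟩ =>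
      hu (hmem b hb hbz a ha hab)
  obtain ⟨a, ⟨_, b, hb, hab, hbz⟩, hxa⟩ := h A hA hd z hlub le_rfl
  exact ⟨b, hb, hab.of_le hxa, hbz⟩

/-- Iterated interpolation; it supplies coefficients that grow strictly in the sense of `≪` at every
stage without leaving the bound `z`. -/
theorem IsDomainBasis.exists_seq_between (hB : IsDomainBasis B) {x z : D} (h : WayBelow x z) :
    ∃ u : ℕ → D, (∀ n, WayBelow x (u n)) ∧ (∀ n, WayBelow (u n) (u (n + 1))) ∧
      ∀ n, WayBelow (u n) z := by
  have step : ∀ y : {y : D // WayBelow x y ∧ WayBelow y z},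
      ∃ y' : {y : D // WayBelow x y ∧ WayBelow y z}, WayBelow y.1 y'.1 := by
    rintro ⟨y, hxy, hyz⟩
    obtain ⟨y', _, h1, h2⟩ := hB.interpolate hyz
    exact ⟨⟨y', h1.of_le hxy.le, h2⟩, h1⟩
  choose f hf using step
  obtain ⟨y₀, _, h1, h2⟩ := hB.interpolate h
  let u : ℕ → {y : D // WayBelow x y ∧ WayBelow y z} := fun n => f^[n] ⟨y₀, h1, h2⟩
  refine ⟨fun n => (u n).1, fun n => (u n).2.1, fun n => ?_, fun n => (u n).2.2⟩
  have : u (n + 1) = f (u n) := Function.iterate_succ_apply' f n _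
  change WayBelow (u n).1 (u (n + 1)).1
  exact this ▸ hf _

/-- Interpolation is what makes the set inaccessible by directed suprema: the intermediate element
is reached by some member of the directed set. -/
theorem IsDomainBasis.isOpen_wayAbove [TopologicalSpace D] [Topology.IsScott D univ]
    (hB : IsDomainBasis B) (x : D) : IsOpen {y | WayBelow x y} := by
  rw [Topology.IsScott.isOpen_iff_isUpperSet_and_dirSupInaccOn (D := univ)]
  refine ⟨fun a b hab ha => ha.trans_le hab, ?_⟩
  intro A _ hA hd s hs (hxs : WayBelow x s)
  obtain ⟨y, _, hxy, hys⟩ := hB.interpolate hxs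
  obtain ⟨a, ha, hya⟩ := hys A hA hd s hs le_rfl
  exact ⟨a, ha, hxy.trans_le hya⟩

end Order

/-- On a compact space a function lying locally below members of a directed set of random variables
lies below a single member. -/
theorem exists_forall_le_of_eventually {Ω : Type*} [TopologicalSpace Ω]
    [CompactSpace Ω] {D : Type*} [PartialOrder D] [TopologicalSpace D] {A : Set C(Ω, D)}
    (hA : A.Nonempty) (hd : DirectedOn (· ≤ ·) A) {f : Ω → D}
    (h : ∀ ω, ∃ a ∈ A, ∀ᶠ ω' in nhds ω, f ω' ≤ a ω') : ∃ a ∈ A, ∀ ω, f ω ≤ a ω := by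
  have key : ∃ a ∈ A, ∀ ω ∈ (univ : Set Ω), f ω ≤ a ω := by
    refine isCompact_univ.induction_on (p := fun t => ∃ a ∈ A, ∀ ω ∈ t, f ω ≤ a ω) ?_ ?_ ?_ ?_
    · exact ⟨hA.some, hA.some_mem, by simp⟩
    · rintro s t hst ⟨a, ha, hat⟩
      exact ⟨a, ha, fun ω hω => hat ω (hst hω)⟩
    · rintro s t ⟨a, ha, has⟩ ⟨b, hb, hbt⟩
      obtain ⟨c, hc, hac, hbc⟩ := hd a ha b hb
      exact ⟨c, hc, fun ω hω => hω.elim (fun h => (has ω h).trans (hac ω))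
        fun h => (hbt ω h).trans (hbc ω)⟩
    · intro ω _
      obtain ⟨a, ha, hev⟩ := h ω
      exact ⟨_, mem_nhdsWithin_of_mem_nhds hev, a, ha, fun _ h => h⟩
  obtain ⟨a, ha, h⟩ := key
  exact ⟨a, ha, fun ω => h ω (mem_univ ω)⟩

/-! ### Random variables: pointwise suprema and step functions. -/

section FunctionSpace

variable {Ω : Type*} [TopologicalSpace Ω] {D : Type*} [PartialOrder D] [TopologicalSpace D]
  [Topology.IsScott D univ]

/-- A function that locally dominates its own values is continuous for the Scott topology. -/
theorem continuous_of_eventually_le {f : Ω → D} (h : ∀ ω, ∀ᶠ ω' in nhds ω, f ω ≤ f ω') :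
    Continuous f := by
  refine continuous_def.2 fun V hV => isOpen_iff_mem_nhds.2 fun ω hω => ?_
  filter_upwards [h ω] with ω' hω'
  exact Topology.IsScott.isUpperSet_of_isOpen (D := univ) hV hω' hω

/-- Directed families of random variables have pointwise computed suprema. -/
theorem exists_continuousMap_isLUB
    (hD : ∀ A : Set D, A.Nonempty → DirectedOn (· ≤ ·) A → ∃ s, IsLUB A s)
    {A : Set C(Ω, D)} (hA : A.Nonempty) (hd : DirectedOn (· ≤ ·) A) :
    ∃ s : C(Ω, D), IsLUB A s ∧ ∀ ω, IsLUB ((fun a : C(Ω, D) => a ω) '' A) (s ω) := by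
  have hdir : ∀ ω, DirectedOn (· ≤ ·) ((fun a : C(Ω, D) => a ω) '' A) := by
    rintro ω _ ⟨a, ha, rfl⟩ _ ⟨b, hb, rfl⟩
    obtain ⟨c, hc, hac, hbc⟩ := hd a ha b hb
    exact ⟨c ω, ⟨c, hc, rfl⟩, hac ω, hbc ω⟩
  choose s hs using fun ω => hD _ (hA.image fun a : C(Ω, D) => a ω) (hdir ω)
  have hcont : Continuous s := by
    refine continuous_def.2 fun V hV => isOpen_iff_mem_nhds.2 fun ω hω => ?_
    obtain ⟨_, ⟨a, ha, rfl⟩, haV⟩ :=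
      ((Topology.IsScott.isOpen_iff_isUpperSet_and_dirSupInaccOn (D := univ)).1 hV).2
        (mem_univ _) (hA.image _) (hdir ω) (hs ω) hω
    filter_upwards [(hV.preimage a.continuous).mem_nhds haV] with ω' hω'
    exact Topology.IsScott.isUpperSet_of_isOpen (D := univ) hV ((hs ω').1 ⟨a, ha, rfl⟩) hω'
  refine ⟨⟨s, hcont⟩, ⟨fun a ha ω => (hs ω).1 ⟨a, ha, rfl⟩, fun b hb ω => (hs ω).2 ?_⟩, hs⟩
  rintro _ ⟨a, ha, rfl⟩
  exact hb ha ω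

theorem IsScottDomain.isLUB_apply [OrderBot D] (hD : IsScottDomain D)
    {A : Set C(Ω, D)} (hA : A.Nonempty) (hd : DirectedOn (· ≤ ·) A) {s : C(Ω, D)}
    (hs : IsLUB A s) (ω : Ω) : IsLUB ((fun a : C(Ω, D) => a ω) '' A) (s ω) := by
  obtain ⟨t, ht, ht'⟩ := exists_continuousMap_isLUB hD.exists_isLUB_of_directedOn hA hd
  exact hs.unique ht ▸ ht' ω

/-- A finite supremum of step functions is way below a random variable as soon as each of its
values is locally way below that random variable, uniformly on the closures of the steps. -/
theorem wayBelow_of_steps [CompactSpace Ω] [OrderBot D] (hD : IsScottDomain D) {ι : Type*}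
    [Finite ι] {d : ι → D} {O : ι → Set Ω} {f g : C(Ω, D)}
    (hf : ∀ ω, IsLUB (range fun i => singleStep (d i) (O i) ω) (f ω))
    (hg : ∀ i, ∀ ω ∈ closure (O i), WayBelow (d i) (g ω)) : WayBelow f g := by
  obtain ⟨B, _, hB⟩ := hD.exists_countable_basis
  intro A hA hd s hs hgs
  refine exists_forall_le_of_eventually hA hd fun ω => ?_
  obtain ⟨a, ha, hda⟩ : ∃ a ∈ A, ∀ i ∈ {i | ω ∈ closure (O i)}, WayBelow (d i) (a ω) := by
    refine DirectedOn.exists_forall_of_finite hA hd (toFinite _)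
      (fun i a b hab h => h.trans_le (hab ω)) fun i hi => ?_
    -- Interpolating yields `d i ≪ a ω` rather than `d i ≤ a ω`; only the former is an open
    -- condition and so persists near `ω`.
    obtain ⟨y, _, hdy, hyg⟩ := hB.interpolate (hg i ω hi)
    obtain ⟨_, ⟨a, ha, rfl⟩, hya⟩ := hyg _ (hA.image fun a : C(Ω, D) => a ω)
      (by
        rintro _ ⟨a, ha, rfl⟩ _ ⟨b, hb, rfl⟩
        obtain ⟨c, hc, hac, hbc⟩ := hd a ha b hb
        exact ⟨c ω, ⟨c, hc, rfl⟩, hac ω, hbc ω⟩)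
      _ (hD.isLUB_apply hA hd hs ω) (hgs ω)
    exact ⟨a, ha, hdy.trans_le hya⟩
  refine ⟨a, ha, ?_⟩
  have hev : ∀ i, ∀ᶠ ω' in nhds ω, singleStep (d i) (O i) ω' ≤ a ω' := by
    intro i
    by_cases hi : ω ∈ closure (O i)
    · filter_upwards [((hB.isOpen_wayAbove (d i)).preimage a.continuous).mem_nhds (hda i hi)]
        with ω' hω'
      unfold singleStep
      split_ifs
      · exact WayBelow.le hω'
      · exact bot_le
    · filter_upwards [isClosed_closure.isOpen_compl.mem_nhds hi] with ω' hω'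
      have : ω' ∉ O i := fun h => hω' (subset_closure h)
      simp [singleStep, this]
  filter_upwards [Filter.eventually_all.2 hev] with ω' hω'
  refine (hf ω').2 ?_
  rintro _ ⟨i, rfl⟩
  exact hω' i

/-- The pointwise supremum of finitely many bounded step functions with open steps is a random
variable. -/
theorem exists_continuousMap_isLUB_steps [OrderBot D] (hD : IsScottDomain D) {ι : Type*} [Finite ι]
    {d : ι → D} {O : ι → Set Ω} (hO : ∀ i, IsOpen (O i)) {r : Ω → D}
    (hr : ∀ i, ∀ ω ∈ O i, d i ≤ r ω) :
    ∃ f : C(Ω, D), ∀ ω, IsLUB (range fun i => singleStep (d i) (O i) ω) (f ω) := by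
  have hbdd : ∀ ω, BddAbove (range fun i => singleStep (d i) (O i) ω) := by
    refine fun ω => ⟨r ω, ?_⟩
    rintro _ ⟨i, rfl⟩
    simp only [singleStep]
    split_ifs with h
    · exact hr i ω h
    · exact bot_le
  choose f hf using fun ω => hD.exists_isLUB_of_bddAbove _ (hbdd ω)
  refine ⟨⟨f, continuous_of_eventually_le fun ω => ?_⟩, hf⟩
  have hev : ∀ i, ∀ᶠ ω' in nhds ω, singleStep (d i) (O i) ω ≤ singleStep (d i) (O i) ω' := by
    intro i
    by_cases hi : ω ∈ O i
    · filter_upwards [(hO i).mem_nhds hi] with ω' hω'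
      simp [singleStep, hi, hω']
    · simp [singleStep, hi]
  filter_upwards [Filter.eventually_all.2 hev] with ω' hω'
  refine (hf ω).2 ?_
  rintro _ ⟨i, rfl⟩
  exact (hω' i).trans ((hf ω').1 ⟨i, rfl⟩)

end FunctionSpace

/-! ### Valuations: directed suprema and a criterion for `≪`. -/

section Valuations

variable {Y : Type*} [TopologicalSpace Y]

/-- Directed suprema of normalised continuous valuations are computed pointwise. -/
theorem NormValuation.isLUB_apply {A : Set (NormValuation Y)} (hA : A.Nonempty)
    (hd : DirectedOn (· ≤ ·) A) {σ : NormValuation Y} (hσ : IsLUB A σ) (U : Opens Y) :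
    σ.toFun U = ⨆ α ∈ A, α.toFun U := by
  let τ : NormValuation Y :=
    { toFun := fun U => ⨆ α : A, α.1.toFun U
      modular := fun U V => by
        have hsup : ∀ U V : Opens Y, (⨆ α : A, α.1.toFun U) + (⨆ α : A, α.1.toFun V) =
            ⨆ α : A, (α.1.toFun U + α.1.toFun V) := fun U V =>
          ENNReal.iSup_add_iSup fun α β => by
            obtain ⟨γ, hγ, hαγ, hβγ⟩ := hd α α.2 β β.2
            exact ⟨⟨γ, hγ⟩, add_le_add (hαγ U) (hβγ V)⟩
        rw [hsup, hsup]
        exact iSup_congr fun α => α.1.modular U V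
      map_bot := by simp [NormValuation.map_bot]
      mono := fun U V h => iSup_mono fun α => α.1.mono U V h
      map_sSup := fun S hS hdS => by
        simp only [fun α : A => α.1.map_sSup S hS hdS]
        rw [iSup_comm]
        exact iSup_congr fun U => iSup_comm
      map_top := by
        have : Nonempty A := hA.to_subtype
        simp [NormValuation.map_top] }
  have hτ : IsLUB A τ := by
    refine ⟨fun α hα U => le_iSup (fun α : A => α.1.toFun U) ⟨α, hα⟩, fun β hβ U => ?_⟩
    exact iSup_le fun α => hβ α.2 U
  rw [hσ.unique hτ, ← iSup_subtype'' A fun α : NormValuation Y => α.toFun U]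

end Valuations

/-- A random variable `a` of finite range has a distribution way below that of `r` as soon as every
event of taking a value above some member of a set `S ∌ ⊥` grows strictly in measure when passing
to the event that `r` takes a value way above some member of `S`. -/
theorem probMap_wayBelow_probMap {Ω D : Type*} [TopologicalSpace Ω] [SecondCountableTopology Ω]
    [MeasurableSpace Ω] [BorelSpace Ω] [PartialOrder D] [OrderBot D] [TopologicalSpace D]
    [Topology.IsScott D univ] {B : Set D} (hB : IsDomainBasis B) (ν : Measure Ω)
    [IsProbabilityMeasure ν] {a r : C(Ω, D)} (ha : (range a).Finite)
    (h : ∀ S : Set D, ⊥ ∉ S → {ω | ∃ s ∈ S, s ≤ a ω}.Nonempty →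
      ν {ω | ∃ s ∈ S, s ≤ a ω} < ν {ω | ∃ s ∈ S, WayBelow s (r ω)}) :
    WayBelow (probMap ν a) (probMap ν r) := by
  intro A hA hd σ hσ hrσ
  -- Only finitely many `S` occur, so directedness will give one `α` for all. It is uniform in `V`
  -- because the open set `W` of points way above `S` lies in every open `V ⊇ S`.
  have key : ∀ S ∈ 𝒫 (range a), ∃ α ∈ A, ⊥ ∉ S → {ω | ∃ s ∈ S, s ≤ a ω}.Nonempty →
      ∀ V : Opens D, S ⊆ V → ν {ω | ∃ s ∈ S, s ≤ a ω} ≤ α.toFun V := by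
    intro S _
    by_cases hS : ⊥ ∉ S ∧ {ω | ∃ s ∈ S, s ≤ a ω}.Nonempty
    · let W : Opens D := ⟨⋃ s ∈ S, {y | WayBelow s y},
        isOpen_biUnion fun s _ => hB.isOpen_wayAbove s⟩
      have hlt : ν {ω | ∃ s ∈ S, s ≤ a ω} < ⨆ α ∈ A, α.toFun W := by
        rw [← NormValuation.isLUB_apply hA hd hσ]
        refine lt_of_lt_of_le ((h S hS.1 hS.2).trans_le (le_of_eq ?_)) (hrσ W)
        change _ = ν (r ⁻¹' (⋃ s ∈ S, {y | WayBelow s y}))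
        congr 1
        ext ω
        simp
      obtain ⟨α, hα, hlt⟩ := lt_biSup_iff.1 hlt
      refine ⟨α, hα, fun _ _ V hV => hlt.le.trans (α.mono _ _ ?_)⟩
      intro y hy
      obtain ⟨s, hs, hsy⟩ := mem_iUnion₂.1 hy
      exact Topology.IsScott.isUpperSet_of_isOpen (D := univ) V.isOpen (WayBelow.le hsy) (hV hs)
    · exact ⟨hA.some, hA.some_mem, fun h1 h2 => absurd ⟨h1, h2⟩ hS⟩
  obtain ⟨α, hα, hall⟩ := DirectedOn.exists_forall_of_finite hA hd ha.powerset
    (by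
      intro S α β hαβ h h1 h2 V hV
      exact (h h1 h2 V hV).trans (hαβ V)) key
  refine ⟨α, hα, fun V => ?_⟩
  change ν (a ⁻¹' V) ≤ α.toFun V
  -- An open set containing `⊥` is the whole space, where no strict gain is possible; normalisation
  -- settles this case.
  by_cases hbot : ⊥ ∈ V
  · have hV : V = ⊤ := by
      ext y
      simpa using Topology.IsScott.isUpperSet_of_isOpen (D := univ) V.isOpen bot_le hbot
    rw [hV, α.map_top]
    exact prob_le_one
  · rcases (a ⁻¹' (V : Set D)).eq_empty_or_nonempty with he | ⟨ω, hω⟩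
    · simp [he]
    · have hsub : a ⁻¹' (V : Set D) ⊆ {ω | ∃ s ∈ (V : Set D) ∩ range a, s ≤ a ω} :=
        fun ω hω => ⟨a ω, ⟨hω, mem_range_self ω⟩, le_rfl⟩
      exact (measure_mono hsub).trans (hall _ inter_subset_right (fun h => hbot h.1)
        ⟨ω, hsub hω⟩ V inter_subset_left)

/-- A class of open sets that is closed under finite unions and contains neighbourhood bases of all
points outside an exceptional set `N`. -/
structure IsBasicClass {Ω : Type*} [TopologicalSpace Ω] (basic : Set Ω → Prop) (N : Set Ω) :
    Prop where
  empty : basic ∅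
  union : ∀ U V, basic U → basic V → basic (U ∪ V)
  isOpen : ∀ U, basic U → IsOpen U
  exists_mem_subset :
    ∀ U : Set Ω, IsOpen U → ∀ ω ∈ U, ω ∉ N → ∃ O, basic O ∧ ω ∈ O ∧ O ⊆ U

/-! ### Exhausting open sets by basic open sets. -/

section BasicClass

variable {Ω : Type*} [TopologicalSpace Ω] {basic : Set Ω → Prop} {N : Set Ω}

/-- Compactness reduces this to one point, where regularity gives a closed neighbourhood inside `U`
and the basic class a smaller basic set. -/
theorem IsBasicClass.exists_between [RegularSpace Ω] (hb : IsBasicClass basic N) {K U : Set Ω}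
    (hK : IsCompact K) (hU : IsOpen U) (hKU : K ⊆ U) (hUN : Disjoint U N) :
    ∃ O, basic O ∧ K ⊆ O ∧ closure O ⊆ U := by
  refine hK.induction_on (p := fun t => ∃ O, basic O ∧ t ⊆ O ∧ closure O ⊆ U) ?_ ?_ ?_ ?_
  · exact ⟨∅, hb.empty, subset_rfl, by simp⟩
  · rintro s t hst ⟨O, hO, htO, hOU⟩
    exact ⟨O, hO, hst.trans htO, hOU⟩
  · rintro s t ⟨O, hO, hsO, hOU⟩ ⟨O', hO', htO', hOU'⟩
    refine ⟨O ∪ O', hb.union _ _ hO hO', union_subset_union hsO htO', ?_⟩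
    rw [closure_union]
    exact union_subset hOU hOU'
  · intro ω hω
    obtain ⟨C, hC, hCcl, hCU⟩ := exists_mem_nhds_isClosed_subset (hU.mem_nhds (hKU hω))
    obtain ⟨O, hO, hωO, hOC⟩ := hb.exists_mem_subset _ isOpen_interior ω
      (mem_interior_iff_mem_nhds.2 hC) (disjoint_left.1 hUN (hKU hω))
    exact ⟨O, mem_nhdsWithin_of_mem_nhds ((hb.isOpen O hO).mem_nhds hωO), O, hO, subset_rfl,
      (closure_minimal (hOC.trans interior_subset) hCcl).trans hCU⟩

/-- An open set in a metrizable space is a countable union of closed, here compact, sets `F n`. Each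
basic set is chosen to swallow `F n` and the closure of its predecessor. -/
theorem IsBasicClass.exists_exhaustion [CompactSpace Ω] [MetrizableSpace Ω]
    (hb : IsBasicClass basic N) {U : Set Ω} (hU : IsOpen U) (hUN : Disjoint U N) :
    ∃ f : ℕ → Set Ω, (∀ n, basic (f n)) ∧ (∀ n, closure (f n) ⊆ f (n + 1)) ∧ ⋃ n, f n = U := by
  let := metrizableSpaceMetric Ω
  obtain ⟨F, hF, hFU, hFu, _⟩ := hU.exists_iUnion_isClosed
  have step : ∀ (n : ℕ) (P : {O : Set Ω // basic O ∧ closure O ⊆ U}),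
      ∃ P' : {O : Set Ω // basic O ∧ closure O ⊆ U}, F n ∪ closure P.1 ⊆ P'.1 := by
    rintro n ⟨O, hO, hOU⟩
    obtain ⟨O', hO', hsub, hOU'⟩ := hb.exists_between
      ((hF n).isCompact.union isClosed_closure.isCompact) hU (union_subset (hFU n) hOU) hUN
    exact ⟨⟨O', hO', hOU'⟩, hsub⟩
  choose g hg using step
  let f : ℕ → {O : Set Ω // basic O ∧ closure O ⊆ U} :=
    fun n => Nat.rec ⟨∅, hb.empty, by simp⟩ g n
  have hf : ∀ n, F n ∪ closure (f n).1 ⊆ (f (n + 1)).1 := fun n => hg n (f n)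
  refine ⟨fun n => (f n).1, fun n => (f n).2.1, fun n => subset_union_right.trans (hf n), ?_⟩
  refine subset_antisymm (iUnion_subset fun n => subset_closure.trans (f n).2.2) ?_
  exact hFu.symm.subset.trans <| iUnion_subset fun n =>
    (subset_union_left.trans (hf n)).trans (subset_iUnion (fun n => (f n).1) (n + 1))

end BasicClass

/-- The value at a point depends only on which steps contain it, and there are finitely many such
patterns. -/
theorem finite_range_of_isLUB_steps {Ω D : Type*} [PartialOrder D] [OrderBot D] {ι : Type*}
    [Finite ι] {d : ι → D} {O : ι → Set Ω} {f : Ω → D}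
    (hf : ∀ ω, IsLUB (range fun i => singleStep (d i) (O i) ω) (f ω)) : (range f).Finite := by
  let key : Ω → ι → Prop := fun ω i => ω ∈ O i
  have hfac : f.FactorsThrough key := by
    intro ω ω' h
    have hi : (fun i => singleStep (d i) (O i) ω) = fun i => singleStep (d i) (O i) ω' := by
      funext i
      have hi : ω ∈ O i ↔ ω' ∈ O i := iff_of_eq (congrFun h i)
      unfold singleStep
      split_ifs <;> tauto
    exact (hi ▸ hf ω).unique (hf ω')
  rw [← hfac.extend_comp (fun _ => (⊥ : D)), range_comp]
  exact (toFinite (range key)).image _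

/-! ### Punctured steps and the approximating sequence. -/

section Approximation

variable {Ω : Type*} [TopologicalSpace Ω] {D : Type*} [PartialOrder D] [OrderBot D]

/-- Countably many step functions whose values are way below a random variable on the steps, and
which generate it. -/
theorem exists_generating_steps [TopologicalSpace D] [Topology.IsScott D univ] [Nonempty Ω]
    [SecondCountableTopology Ω] (hD : IsScottDomain D) (r : C(Ω, D)) :
    ∃ (d e : ℕ → D) (O : ℕ → Set Ω), (∀ k, WayBelow (d k) (e k)) ∧ (∀ k, IsOpen (O k)) ∧
      (∀ k, ∀ ω ∈ O k, WayBelow (e k) (r ω)) ∧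
      ∀ ω, IsLUB {x | ∃ k, ω ∈ O k ∧ x = d k} (r ω) := by
  obtain ⟨B, hBc, hB⟩ := hD.exists_countable_basis
  -- The middle entry, strictly between coefficient and values of `r`, leaves room to let the
  -- coefficient increase later.
  let I : Set (D × D × Set Ω) := {p | p.1 ∈ B ∧ p.2.1 ∈ B ∧ p.2.2 ∈ countableBasis Ω ∧
    WayBelow p.1 p.2.1 ∧ ∀ ω ∈ p.2.2, WayBelow p.2.1 (r ω)}
  have hIc : I.Countable := by
    refine (hBc.prod (hBc.prod (countable_countableBasis Ω))).mono ?_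
    rintro ⟨x, y, U⟩ ⟨h1, h2, h3, -⟩
    exact ⟨h1, h2, h3⟩
  have hex : ∀ ω, ∀ b ∈ B, WayBelow b (r ω) → ∃ e U, (b, e, U) ∈ I ∧ ω ∈ U := by
    intro ω b hb hbr
    obtain ⟨e, he, hbe, her⟩ := hB.interpolate hbr
    obtain ⟨U, hU, hωU, hUsub⟩ := (isBasis_countableBasis Ω).exists_subset_of_mem_open
      (show ω ∈ r ⁻¹' {y | WayBelow e y} from her)
      ((hB.isOpen_wayAbove e).preimage r.continuous)
    exact ⟨e, U, ⟨hb, he, hU, hbe, hUsub⟩, hωU⟩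
  have hIne : I.Nonempty := by
    obtain ⟨ω⟩ := ‹Nonempty Ω›
    obtain ⟨b, hb, hbr⟩ := (hB (r ω)).1
    obtain ⟨e, U, h, _⟩ := hex ω b hb hbr
    exact ⟨_, h⟩
  obtain ⟨p, hp⟩ := hIc.exists_eq_range hIne
  have hpI : ∀ k, p k ∈ I := fun k => hp ▸ mem_range_self k
  refine ⟨fun k => (p k).1, fun k => (p k).2.1, fun k => (p k).2.2, fun k => (hpI k).2.2.2.1,
    fun k => isOpen_of_mem_countableBasis (hpI k).2.2.1, fun k => (hpI k).2.2.2.2, fun ω => ?_⟩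
  constructor
  · rintro _ ⟨k, hk, rfl⟩
    exact (hpI k).2.2.2.1.le.trans ((hpI k).2.2.2.2 ω hk).le
  · refine fun u hu => (hB (r ω)).2.2.2 fun b ⟨hb, hbr⟩ => ?_
    obtain ⟨e, U, h, hωU⟩ := hex ω b hb hbr
    rw [hp] at h
    obtain ⟨k, hk⟩ := h
    exact hu ⟨k, by simpa [hk] using hωU, by simp [hk]⟩

/-- The combinatorial core: if, for every `j ≤ n`, the steps with index at least `j` all stay away
from a point of every nonempty intersection of steps with index at most `j`, then the supremum `f`
of the shrunk steps misses a nonempty open part of each event that `r` is way above some member of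
a set `S ∌ ⊥`. -/
theorem exists_isOpen_of_shrunk_steps [TopologicalSpace D] [Topology.IsScott D univ]
    (hD : IsScottDomain D) {n : ℕ} {d : ℕ → D} {O P : ℕ → Set Ω} {f r : C(Ω, D)}
    {q : Finset ℕ → Ω} (hO : ∀ k, IsOpen (O k)) (hPO : ∀ k, P k ⊆ O k)
    (hq : ∀ K : Finset ℕ, (∃ ω, ∀ k ∈ K, ω ∈ O k) → ∀ k ∈ K, q K ∈ O k)
    (hPq : ∀ k, ∀ K ⊆ Finset.range (k + 1), q K ∉ closure (P k))
    (hr : ∀ k, ∀ ω ∈ O k, WayBelow (d k) (r ω))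
    (hf : ∀ ω, IsLUB (range fun k : Fin n => singleStep (d k) (P k) ω) (f ω))
    {S : Set D} (hbot : ⊥ ∉ S) (hne : {ω | ∃ s ∈ S, s ≤ f ω}.Nonempty) :
    ∃ G : Set Ω, IsOpen G ∧ G.Nonempty ∧
      ∀ ω ∈ G, (∃ s ∈ S, WayBelow s (r ω)) ∧ ¬ ∃ s ∈ S, s ≤ f ω := by
  classical
  -- Some compatible set of steps with indices below `j` has coefficients reaching `S`. Membership
  -- in `lowerBounds (upperBounds _)` says that `s` is below their supremum without presupposing
  -- that it exists.
  let Good : ℕ → Prop := fun j => ∃ K ⊆ Finset.range j, (∃ ω, ∀ k ∈ K, ω ∈ O k) ∧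
    ∃ s ∈ S, s ∈ lowerBounds (upperBounds (d '' K))
  have hfu : ∀ ω, ∀ u ∈ upperBounds (d '' {k | k < n ∧ ω ∈ P k}), f ω ≤ u := by
    intro ω u hu
    refine (hf ω).2 ?_
    rintro _ ⟨k, rfl⟩
    simp only [singleStep]
    split_ifs with h
    · exact hu ⟨k, ⟨k.2, h⟩, rfl⟩
    · exact bot_le
  have hgood : ∀ (j : ℕ) (ω : Ω), (∀ k < n, ω ∈ P k → k < j) → (∃ s ∈ S, s ≤ f ω) → Good j := by
    rintro j ω hj ⟨s, hs, hsf⟩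
    refine ⟨(Finset.range j).filter fun k => k < n ∧ ω ∈ P k, Finset.filter_subset _ _,
      ⟨ω, fun k hk => hPO k (Finset.mem_filter.1 hk).2.2⟩, s, hs, fun u hu => ?_⟩
    refine hsf.trans (hfu ω u ?_)
    rintro _ ⟨k, hk, rfl⟩
    exact hu ⟨k, by simpa using ⟨hj k hk.1 hk.2, hk⟩, rfl⟩
  have hex : ∃ j, Good j := by
    obtain ⟨ω, hω⟩ := hne
    exact ⟨n, hgood n ω (fun k hk _ => hk) hω⟩
  have hmin := fun j hj => Nat.find_min hex (m := j) hj
  obtain ⟨K, hK, hKne, s, hs, hsK⟩ := Nat.find_spec hex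
  -- At level `0` the only set of steps is empty, with supremum `⊥`, which would force `⊥ ∈ S`.
  obtain ⟨j, hj⟩ : ∃ j, Nat.find hex = j + 1 := by
    refine Nat.exists_eq_succ_of_ne_zero fun h0 => hbot ?_
    rw [h0, Finset.range_zero, Finset.subset_empty] at hK
    subst hK
    have : s ≤ ⊥ := hsK (by simp)
    exact le_bot_iff.1 this ▸ hs
  rw [hj] at hK hmin
  -- The first factor keeps `r` way above the coefficients indexed by `K`; the second switches off
  -- all steps with index at least `j`, so that `f` being above `S` would make level `j` good. As
  -- `K` has indices at most `j`, the point `q K` was removed from each of those steps, including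
  -- step `j` itself.
  refine ⟨(⋂ k ∈ K, O k) ∩ ⋂ k ∈ Finset.Ico j n, (closure (P k))ᶜ, ?_, ⟨q K, ?_, ?_⟩, ?_⟩
  · exact (isOpen_biInter_finset fun k _ => hO k).inter
      (isOpen_biInter_finset fun k _ => isClosed_closure.isOpen_compl)
  · exact mem_iInter₂.2 fun k hk => hq K hKne k hk
  · refine mem_iInter₂.2 fun k hk => hPq k K (hK.trans ?_)
    exact Finset.range_subset_range.2 (Nat.succ_le_succ (Finset.mem_Ico.1 hk).1)
  · rintro ω ⟨hωO, hωP⟩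
    have hdr : ∀ x ∈ d '' K, WayBelow x (r ω) := by
      rintro _ ⟨k, hk, rfl⟩
      exact hr k ω (mem_iInter₂.1 hωO k hk)
    refine ⟨⟨s, hs, ?_⟩, fun h => hmin j j.lt_succ_self (hgood j ω (fun k hk hkP => ?_) h)⟩
    · obtain ⟨x, hx⟩ := hD.exists_isLUB_of_bddAbove (d '' K) ⟨r ω, fun x hx => (hdr x hx).le⟩
      exact (WayBelow.of_isLUB (K.finite_toSet.image d) hx hdr).of_le (hsK hx.1)
    · by_contra hjk
      exact mem_iInter₂.1 hωP k (Finset.mem_Ico.2 ⟨not_lt.1 hjk, hk⟩) (subset_closure hkP)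

/-- Approximation of random variables by simple ones on a compact metrizable sample space. -/
theorem exists_simple_approximation [CompactSpace Ω] [MetrizableSpace Ω]
    [SecondCountableTopology Ω] [MeasurableSpace Ω] [BorelSpace Ω] {ν : Measure Ω}
    [IsProbabilityMeasure ν] [ν.IsOpenPosMeasure] [NullSingletonClass ν] {basic : Set Ω → Prop}
    {N : Set Ω} (hN : N.Finite) (hb : IsBasicClass basic N) (hD : IsScottDomain D) [TopologicalSpace D]
    [Topology.IsScott D univ] (r : C(Ω, D)) :
    ∃ ρ : ℕ → C(Ω, D), (∀ i, IsSimpleRV basic (ρ i)) ∧ Monotone ρ ∧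
      (∀ i, WayBelow (ρ i) (ρ (i + 1))) ∧ (∀ i, WayBelow (probMap ν (ρ i)) (probMap ν r)) ∧
      ∃ s : C(Ω, D), IsLUB (range ρ) s ∧ (∀ ω, IsLUB (range fun i => ρ i ω) (s ω)) ∧
        ∀ᵐ ω ∂ν, s ω = r ω := by
  classical
  have : Nonempty Ω := nonempty_of_isProbabilityMeasure ν
  obtain ⟨B, _, hB⟩ := hD.exists_countable_basis
  obtain ⟨d₀, e, O, hde, hO, her, hlub⟩ := exists_generating_steps hD r
  choose d hd₀ hd hdlt using fun k => hB.exists_seq_between (hde k)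
  have hq : ∃ q : Finset ℕ → Ω, ∀ K : Finset ℕ, (∃ ω, ∀ k ∈ K, ω ∈ O k) → ∀ k ∈ K, q K ∈ O k := by
    refine Classical.axiomOfChoice (r := fun (K : Finset ℕ) (x : Ω) =>
      (∃ ω, ∀ k ∈ K, ω ∈ O k) → ∀ k ∈ K, x ∈ O k) fun K => ?_
    by_cases h : ∃ ω, ∀ k ∈ K, ω ∈ O k
    · exact ⟨h.choose, fun _ => h.choose_spec⟩
    · exact ⟨Classical.arbitrary Ω, fun h' => absurd h' h⟩
  obtain ⟨q, hq⟩ := hq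
  -- The punctures of `O k`: representatives of all index sets contained in `{0, …, k}`.
  let Q : ℕ → Finset Ω := fun k => (Finset.range (k + 1)).powerset.image q
  choose P hPb hPP hPU using fun k => hb.exists_exhaustion
    ((hO k).sdiff ((Q k).finite_toSet.union hN).isClosed)
    (disjoint_left.2 fun _ h h' => h.2 (Or.inr h'))
  have hPsub : ∀ k n, closure (P k n) ⊆ O k \ (Q k ∪ N) := fun k n =>
    (hPP k n).trans ((subset_iUnion (P k) (n + 1)).trans (hPU k).subset)
  have hPO : ∀ k n, P k n ⊆ O k := fun k n ω h => (hPsub k n (subset_closure h)).1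
  have hdr : ∀ n k, ∀ ω ∈ O k, WayBelow (d k n) (r ω) := fun n k ω hω =>
    (hdlt k n).trans_le (her k ω hω).le
  choose ρ hρ using fun n => exists_continuousMap_isLUB_steps hD (ι := Fin n)
    (d := fun k => d k n) (O := fun k => P k n) (fun k => hb.isOpen _ (hPb k n)) (r := r)
    fun k ω hω => (hdr n k ω (hPO k n hω)).le
  have hle : ∀ n k, k < n → ∀ ω ∈ P k n, d k n ≤ ρ n ω := by
    intro n k hk ω hω
    exact (hρ n ω).1 ⟨⟨k, hk⟩, by simp [singleStep, hω]⟩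
  have hρr : ∀ n ω, WayBelow (ρ n ω) (r ω) := by
    refine fun n ω => WayBelow.of_isLUB (finite_range _) (hρ n ω) ?_
    rintro _ ⟨k, rfl⟩
    simp only [singleStep]
    split_ifs with h
    · exact hdr n k ω (hPO k n h)
    · exact wayBelow_bot _
  have hstep : ∀ n, WayBelow (ρ n) (ρ (n + 1)) := fun n =>
    wayBelow_of_steps hD (hρ n) fun k ω hω =>
      (hd k n).trans_le (hle (n + 1) k (k.2.trans n.lt_succ_self) ω (hPP k n hω))
  have hmono : Monotone ρ := monotone_nat_of_le_succ fun n => (hstep n).le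
  obtain ⟨s, hs, hsω⟩ := exists_continuousMap_isLUB hD.exists_isLUB_of_directedOn
    (range_nonempty ρ) (hmono.directed_le.directedOn_range)
  have hsω' : ∀ ω, IsLUB (range fun i => ρ i ω) (s ω) := fun ω => by
    have h := hsω ω
    rwa [← range_comp] at h
  refine ⟨ρ, fun n => ⟨n, _, _, fun k => hPb k n, hρ n⟩, hmono, hstep, fun n => ?_, s, hs, hsω', ?_⟩
  · refine probMap_wayBelow_probMap hB ν ?_ fun S hbot hne => ?_
    · exact finite_range_of_isLUB_steps (hρ n)
    · obtain ⟨G, hG, hGne, hGS⟩ := exists_isOpen_of_shrunk_steps hD (d := fun k => d k n) hO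
        (fun k => hPO k n) hq
        (fun k K hK hmem => (hPsub k n hmem).2 <| Or.inl
          (Finset.mem_image_of_mem q (Finset.mem_powerset.2 hK)))
        (hdr n) (hρ n) hbot hne
      have hdisj : Disjoint {ω | ∃ s ∈ S, s ≤ ρ n ω} G :=
        disjoint_left.2 fun ω h1 h2 => (hGS ω h2).2 h1
      calc ν {ω | ∃ s ∈ S, s ≤ ρ n ω}
          < ν {ω | ∃ s ∈ S, s ≤ ρ n ω} + ν G :=
            ENNReal.lt_add_right (measure_ne_top _ _) (hG.measure_pos ν hGne).ne'
        _ = ν ({ω | ∃ s ∈ S, s ≤ ρ n ω} ∪ G) := (measure_union hdisj hG.measurableSet).symm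
        _ ≤ ν {ω | ∃ s ∈ S, WayBelow s (r ω)} := by
            refine measure_mono (union_subset ?_ fun ω hω => (hGS ω hω).1)
            rintro ω ⟨t, ht, htρ⟩
            exact ⟨t, ht, (hρr n ω).of_le htρ⟩
  · have hcount : ((⋃ k, (Q k : Set Ω)) ∪ N).Countable :=
      (countable_iUnion fun k => (Q k).countable_toSet).union hN.countable
    -- Off the countable set of all punctures and exceptional points, membership in `O k` implies
    -- membership in some `P k n`.
    filter_upwards [measure_eq_zero_iff_ae_notMem.1 (hcount.measure_zero ν)] with ω hω
    refine le_antisymm ((hsω' ω).2 ?_) ((hlub ω).2 ?_)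
    · rintro _ ⟨n, rfl⟩
      exact (hρr n ω).le
    · rintro _ ⟨k, hk, rfl⟩
      have hmem : ω ∈ ⋃ n, P k n := by
        rw [hPU k]
        exact ⟨hk, fun h => hω (h.imp (fun h => mem_iUnion.2 ⟨k, h⟩) id)⟩
      obtain ⟨n, hn⟩ := mem_iUnion.1 hmem
      have hPm : Monotone (P k) := monotone_nat_of_le_succ fun n => subset_closure.trans (hPP k n)
      -- The stage must be late enough for `P k` to contain `ω`, and must exceed `k` for step `k` to
      -- take part in it.
      have hm := hPm (le_max_left n (k + 1)) hn
      exact (hd₀ k _).le.trans ((hle _ k (Nat.lt_of_succ_le (le_max_right n (k + 1))) ω hm).trans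
        ((hsω' ω).1 ⟨_, rfl⟩))

end Approximation

/-! ### The Cantor space. -/

theorem coinMeasure_singleton (b : Bool) : coinMeasure {b} = 2⁻¹ := by
  rw [coinMeasure, ProbabilityTheory.uniformOn_univ, Measure.count_singleton]
  simp

theorem cantorMeasure_cylinder (x : ℕ → Bool) (n : ℕ) :
    cantorMeasure (PiNat.cylinder x n) = 2⁻¹ ^ n := by
  rw [PiNat.cylinder_eq_pi, cantorMeasure, Measure.infinitePi_pi _ fun i _ => by measurability]
  simp [coinMeasure_singleton]

instance : cantorMeasure.IsOpenPosMeasure where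
  open_pos U hU := by
    rintro ⟨x, hx⟩
    obtain ⟨_, ⟨y, n, rfl⟩, _, hsub⟩ :=
      (PiNat.isTopologicalBasis_cylinders fun _ => Bool).exists_subset_of_mem_open hx hU
    intro h
    have := measure_mono_null hsub h
    rw [cantorMeasure_cylinder] at this
    simp at this

/-- A point lies in cylinders of measure `2⁻ⁿ` for every `n`. -/
instance : NullSingletonClass cantorMeasure where
  measure_singleton x := by
    refine le_antisymm (ge_of_tendsto' (x := Filter.atTop)
      (ENNReal.tendsto_pow_atTop_nhds_zero_of_lt_one (r := 2⁻¹) ?_) fun n => ?_) zero_le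
    · simp
    · rw [← cantorMeasure_cylinder x n]
      exact measure_mono (singleton_subset_iff.2 (PiNat.self_mem_cylinder x n))

theorem cylinder_eq_piNat_cylinder (x : ℕ → Bool) (n : ℕ) :
    cylinder (fun i : Fin n => x i) = PiNat.cylinder x n := by
  ext y
  exact ⟨fun h i hi => h ⟨i, hi⟩, fun h i => h i i.2⟩

theorem isOpen_cylinder {n : ℕ} (x : Fin n → Bool) : IsOpen (cylinder x) := by
  simp only [cylinder, ofPred_forall]
  exact isOpen_iInter_of_finite fun i =>
    (isOpen_discrete {x i}).preimage (continuous_apply (A := fun _ : ℕ => Bool) (i : ℕ))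

/-- The finite unions of members of a class containing neighbourhood bases form a basic class. -/
theorem isBasicClass_finite_sUnion {Ω : Type*} [TopologicalSpace Ω] {p : Set Ω → Prop}
    {N : Set Ω} (hopen : ∀ U, p U → IsOpen U)
    (hbase : ∀ U : Set Ω, IsOpen U → ∀ ω ∈ U, ω ∉ N → ∃ O, p O ∧ ω ∈ O ∧ O ⊆ U) :
    IsBasicClass (fun U => ∃ 𝒞 : Set (Set Ω), 𝒞.Finite ∧ (∀ C ∈ 𝒞, p C) ∧ U = ⋃₀ 𝒞) N where
  empty := ⟨∅, finite_empty, by simp, by simp⟩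
  union := by
    rintro _ _ ⟨𝒞, h𝒞, hp, rfl⟩ ⟨𝒞', h𝒞', hp', rfl⟩
    exact ⟨𝒞 ∪ 𝒞', h𝒞.union h𝒞', fun C hC => hC.elim (hp C) (hp' C), (sUnion_union _ _).symm⟩
  isOpen := by
    rintro _ ⟨𝒞, _, hp, rfl⟩
    exact isOpen_sUnion fun C hC => hopen C (hp C hC)
  exists_mem_subset U hU ω hω hωN := by
    obtain ⟨O, hO, hωO, hOU⟩ := hbase U hU ω hω hωN
    exact ⟨O, ⟨{O}, finite_singleton O, by simpa using hO, by simp⟩, hωO, hOU⟩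

theorem isBasicClass_isBasicOpenCantor : IsBasicClass IsBasicOpenCantor ∅ := by
  refine isBasicClass_finite_sUnion ?_ fun U hU x hx _ => ?_
  · rintro _ ⟨n, x, rfl⟩
    exact isOpen_cylinder x
  · obtain ⟨_, ⟨y, n, rfl⟩, hxy, hsub⟩ :=
      (PiNat.isTopologicalBasis_cylinders fun _ => Bool).exists_subset_of_mem_open hx hU
    exact ⟨_, ⟨n, _, rfl⟩, (cylinder_eq_piNat_cylinder y n).symm ▸ hxy,
      (cylinder_eq_piNat_cylinder y n).symm ▸ hsub⟩

/-! ### The unit interval. -/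

theorem exists_isDyadic_between {x y : ℝ} (h : x < y) : ∃ a, IsDyadic a ∧ x < a ∧ a < y := by
  -- With mesh `2⁻ⁿ` below `y - x`, the first multiple of the mesh beyond `x` lies before `y`.
  obtain ⟨n, hn⟩ := exists_pow_lt_of_lt_one (sub_pos.2 h) (by norm_num : (1 / 2 : ℝ) < 1)
  have hpos : (0 : ℝ) < 2 ^ n := by positivity
  have hn' : 1 < (y - x) * 2 ^ n := by
    rw [one_div, inv_pow] at hn
    exact (inv_lt_iff_one_lt_mul₀ hpos).1 hn
  have h1 := Int.lt_floor_add_one (x * 2 ^ n)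
  have h2 := Int.floor_le (x * 2 ^ n)
  refine ⟨((⌊x * 2 ^ n⌋ + 1 : ℤ) : ℝ) / 2 ^ n, ⟨_, n, rfl⟩, ?_, ?_⟩
  · rw [lt_div_iff₀ hpos]
    push_cast
    exact h1
  · rw [div_lt_iff₀ hpos]
    push_cast
    linarith

/-- The endpoints are exceptional because the intervals in `IsBasicOpenInterval` are equal, as subsets
of the real line, to `{x | a < x ∧ x < b}`, and hence contain neither `0` nor `1`. -/
theorem isBasicClass_isBasicOpenInterval : IsBasicClass IsBasicOpenInterval {0, 1} := by
  refine isBasicClass_finite_sUnion ?_ fun U hU ω hω hωN => ?_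
  · rintro C ⟨a, b, _, _, hC⟩
    rw [← preimage_image_eq C Subtype.val_injective, hC]
    exact isOpen_Ioo.preimage continuous_subtype_val
  · obtain ⟨V, hV, rfl⟩ := isOpen_induced_iff.1 hU
    obtain ⟨l, u, ⟨hl, hu⟩, hsub⟩ := mem_nhds_iff_exists_Ioo_subset.1 (hV.mem_nhds hω)
    have h0 : (0 : ℝ) < ω := unitInterval.pos_iff_ne_zero.2 fun h => hωN (Or.inl h)
    have h1 : (ω : ℝ) < 1 := unitInterval.lt_one_iff_ne_one.2 fun h => hωN (Or.inr h)
    -- The cut-offs at `0` and `1` keep `Ioo a b` inside the unit interval, so that the image of its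
    -- preimage is all of it.
    obtain ⟨a, ha, hla, haω⟩ := exists_isDyadic_between (max_lt hl h0)
    obtain ⟨b, hb, hωb, hbu⟩ := exists_isDyadic_between (lt_min hu h1)
    rw [max_lt_iff] at hla
    rw [lt_min_iff] at hbu
    refine ⟨Subtype.val ⁻¹' Ioo a b, ⟨a, b, ha, hb, ?_⟩, ⟨haω, hωb⟩,
      fun x hx => hsub ⟨hla.1.trans hx.1, hx.2.trans hbu.1⟩⟩
    rw [Subtype.image_preimage_coe]
    exact inter_eq_right.2 fun x hx => ⟨(hla.2.trans hx.1).le, (hx.2.trans hbu.2).le⟩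

/-- The given point may be an endpoint, but it is in the closure of `(0, 1)`, so the open set meets
`(0, 1)` in a nonempty open subset of the line. -/
instance : (volume : Measure unitInterval).IsOpenPosMeasure where
  open_pos U hU := by
    rintro ⟨ω, hω⟩
    obtain ⟨V, hV, rfl⟩ := isOpen_induced_iff.1 hU
    have hcl : (ω : ℝ) ∈ closure (Ioo (0 : ℝ) 1) := by
      rw [closure_Ioo zero_ne_one]
      exact ω.2
    have hne := mem_closure_iff.1 hcl V hV hω
    rw [unitInterval.volume_apply]
    refine ((hV.inter isOpen_Ioo).measure_pos volume hne).trans_le (measure_mono ?_) |>.ne'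
    rintro x ⟨hxV, hx⟩
    exact ⟨⟨x, hx.1.le, hx.2.le⟩, hxV, rfl⟩

end ScottRV

theorem mainTheorem7 {D : Type*} [PartialOrder D] [OrderBot D] (hD : ScottRV.IsScottDomain D)
    [TopologicalSpace D] [Topology.IsScott D Set.univ] :
    (∀ r : C(ℕ → Bool, D), ∃ ρ : ℕ → C(ℕ → Bool, D),
      (∀ i, ScottRV.IsSimpleRV ScottRV.IsBasicOpenCantor (ρ i)) ∧
      Monotone ρ ∧ (∀ i, ScottRV.WayBelow (ρ i) (ρ (i + 1))) ∧
      (∀ i, ScottRV.WayBelow (ScottRV.probMap ScottRV.cantorMeasure (ρ i))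
        (ScottRV.probMap ScottRV.cantorMeasure r)) ∧
      ∃ s : C(ℕ → Bool, D), IsLUB (Set.range ρ) s ∧
        (∀ ω, IsLUB (Set.range fun i => ρ i ω) (s ω)) ∧
        ∀ᵐ ω ∂ScottRV.cantorMeasure, s ω = r ω) ∧
    (∀ r : C(unitInterval, D), ∃ ρ : ℕ → C(unitInterval, D),
      (∀ i, ScottRV.IsSimpleRV ScottRV.IsBasicOpenInterval (ρ i)) ∧
      Monotone ρ ∧ (∀ i, ScottRV.WayBelow (ρ i) (ρ (i + 1))) ∧
      (∀ i, ScottRV.WayBelow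
        (ScottRV.probMap (volume : MeasureTheory.Measure unitInterval) (ρ i))
        (ScottRV.probMap (volume : MeasureTheory.Measure unitInterval) r)) ∧
      ∃ s : C(unitInterval, D), IsLUB (Set.range ρ) s ∧
        (∀ ω, IsLUB (Set.range fun i => ρ i ω) (s ω)) ∧
        ∀ᵐ ω ∂(volume : MeasureTheory.Measure unitInterval), s ω = r ω) :=
  ⟨fun r => ScottRV.exists_simple_approximation Set.finite_empty
      ScottRV.isBasicClass_isBasicOpenCantor hD r,
    fun r => ScottRV.exists_simple_approximation (Set.toFinite {0, 1})
      ScottRV.isBasicClass_isBasicOpenInterval hD r⟩
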